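/- A Dyck path of semilength $n$ is a lattice path from $(0,0)$ to $(2n,0)$ with steps $U=(1,1)$ and $D=(1,-1)$ that never goes below the $x$-axis; it is identified with a word in $\{U,D\}$. Let $w_{n,k,m}$ be the number of Dyck paths of semilength $n$ with exactly $k$ occurrences of $UD$ and exactly $m$ occurrences of $UUD$ as factors (blocks of consecutive letters), and let $W_{n,k}(x)=\sum_{m=0}^{k}w_{n,k,m}x^m$. For nonzero real-rooted polynomials $F,G$ with nonnegative real coefficients, with zeros (counted with multiplicity) $\alpha_1\ge\alpha_2\ge\cdots$ and $\beta_1\ge\beta_2\ge\cdots$ respectively, write $G\preccurlyeq F$ (equivalently $F\succcurlyeq G$) if either $\deg F=\deg G=d$ and $\beta_d\le\alpha_d\le\beta_{d-1}\le\alpha_{d-1}\le\cdots\le\beta_1\le\alpha_1$, or $\deg F=\deg G+1=d$ and $\alpha_d\le\beta_{d-1}\le\alpha_{d-1}\le\cdots\le\beta_1\le\alpha_1$. By convention, also $a\preccurlyeq bx+c$ for all real $a,b,c$, and $F\preccurlyeq 0$, $0\preccurlyeq F$ for every real-rooted $F$. A finite sequence $F_1,\dots,F_n$ of real-rooted polynomials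 is called Sturm-unimodal if there is $1\le j\le n$ with $$F_1\preccurlyeq\cdots\preccurlyeq F_{j-1}\preccurlyeq F_j\succcurlyeq F_{j+1}\succcurlyeq\cdots\succcurlyeq F_n .$$ **Theorem.** For every $n\ge 1$, the polynomials $W_{n,1}(x),W_{n,2}(x),\dots,W_{n,n}(x)$ are all real-rooted, and the sequence $\{W_{n,k}(x)\}_{1\le k\le n}$ is Sturm-unimodal. -/

import Mathlib

namespace DyckSturm

open Polynomial

/-- The number of occurrences of `f` as a factor (block of consecutive letters) of the word `l`:
the number of positions of `l` at which `f` starts. -/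
def occ (f l : List DyckStep) : ℕ :=
  l.tails.countP (fun t => f.isPrefixOf t)

/-- `w n k m` is the number of Dyck paths of semilength `n` with exactly `k` occurrences of the
factor `UD` and exactly `m` occurrences of the factor `UUD`. -/
def w (n k m : ℕ) : ℕ :=
  (Finset.univ.filter (fun p : {p : DyckWord // p.semilength = n} =>
    occ [DyckStep.U, DyckStep.D] p.1.toList = k ∧
    occ [DyckStep.U, DyckStep.U, DyckStep.D] p.1.toList = m)).card

/-- The polynomial `W_{n,k}(x) = ∑_{m=0}^{k} w_{n,k,m} x^m`, with real coefficients. -/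
noncomputable def W (n k : ℕ) : ℝ[X] :=
  ∑ m ∈ Finset.range (k + 1), C (w n k m : ℝ) * X ^ m

/-- A real polynomial is real-rooted if it is a product of linear factors over `ℝ`
(constants, including `0`, are real-rooted). -/
def RealRooted (p : ℝ[X]) : Prop := p.Splits

/-- The real zeros of `p`, with multiplicity, in weakly decreasing order
(entry `i` of the list is the `(i+1)`-st largest zero). -/
noncomputable def zerosDesc (p : ℝ[X]) : List ℝ := p.roots.sort (· ≥ ·)

/-- The chain `⋯ ≤ β₂ ≤ α₂ ≤ β₁ ≤ α₁` for two lists `α`, `β`, over all the entries present.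
If both have length `n` it reads `βₙ ≤ αₙ ≤ ⋯ ≤ β₁ ≤ α₁`; if `α` has length `n` and `β` has
length `n - 1` it reads `αₙ ≤ βₙ₋₁ ≤ αₙ₋₁ ≤ ⋯ ≤ β₁ ≤ α₁`. -/
def Alternates (β α : List ℝ) : Prop :=
  (∀ (i : ℕ) (hβ : i < β.length) (hα : i < α.length), β[i] ≤ α[i]) ∧
  (∀ (i : ℕ) (hβ : i < β.length) (hα : i + 1 < α.length), α[i + 1] ≤ β[i])

/-- `Interlaces G F` is the relation `G ≼ F` between real-rooted polynomials. The first
alternative is the general definition, for polynomials with nonnegative coefficients; the others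
are the conventions `a ≼ b x + c`, `0 ≼ F` and `G ≼ 0`. -/
def Interlaces (G F : ℝ[X]) : Prop :=
  RealRooted G ∧ RealRooted F ∧
  (((∀ i, 0 ≤ G.coeff i) ∧ (∀ i, 0 ≤ F.coeff i) ∧ G ≠ 0 ∧ F ≠ 0 ∧
      (F.natDegree = G.natDegree ∨ F.natDegree = G.natDegree + 1) ∧
      Alternates (zerosDesc G) (zerosDesc F)) ∨
    (∃ a b c : ℝ, G = C a ∧ F = C b * X + C c) ∨ G = 0 ∨ F = 0)

/-- The finite sequence `F 1, …, F n` of real-rooted polynomials is Sturm-unimodal: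
`F 1 ≼ ⋯ ≼ F j ≽ F (j+1) ≽ ⋯ ≽ F n` for some `1 ≤ j ≤ n`. -/
def SturmUnimodal (n : ℕ) (F : ℕ → ℝ[X]) : Prop :=
  (∀ i, 1 ≤ i → i ≤ n → RealRooted (F i)) ∧
  ∃ j, 1 ≤ j ∧ j ≤ n ∧
    (∀ i, 1 ≤ i → i < j → Interlaces (F i) (F (i + 1))) ∧
    (∀ i, j ≤ i → i < n → Interlaces (F (i + 1)) (F i))

end DyckSturm

/-!
Cut a Dyck word after each letter `D` into blocks `U ⋯ U D`. The numbers of factors `UD` and `UUD`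
are additive over blocks, so `y ^ #UD * x ^ #UUD` is a product of block weights `[z^c] ψ`, where `c`
is the number of letters `U` in the block and `ψ = 1 + y z + x y z² / (1 - z)`. Removing the first
block of a suffix of a Dyck word gives a recursion, solved by `[z^u] (ψ - z ψ') ψ^d` for suffixes
with `u` letters `U` and `d` letters `D`; for `u = d = n` this says that `n + 1` times the weighted
number of Dyck words of semilength `n` is `[z^n] ψ^(n+1)`. Extracting coefficients, `W_{n,k}` is a
positive multiple of `x N_{k-1,n-k-1}(x)` for `k < n`, where
`N_{a,b}(x) = ∑ⱼ C(a, j) C(b, j) / (j + 1) xʲ`, and `W_{n,n}` is constant.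

A recurrence expresses `N_{a+1,b}` through `N_{a,b}` and its derivative. At a zero of `N_{a,b}`,
which is negative, it gives `N_{a+1,b}` the sign opposite to `N_{a,b}'`, so when `a < b` the zeros
of `N_{a,b}` strictly separate those of `N_{a+1,b}`, and by induction all zeros are real and
simple. A shift identity shows that, for `a < b`, the values of `N_{a+1,b}` and `N_{a+1,b+1}` at the
zeros of `N_{a,b+1}` have the same sign, so `N_{a,b+1} ≼ N_{a+1,b}`. This is `W_{n,k} ≼ W_{n,k+1}`
for `k` below the middle, and the symmetry `N_{a,b} = N_{b,a}` reverses the relation above it.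
-/

namespace DyckSturm

/-! ### Counting Dyck paths by `UD` and `UUD` -/

section Counting

open DyckStep Finset.HasAntidiagonal

/-- The suffixes of Dyck words: no suffix of `l` has more letters `U` than letters `D`. -/
def IsBallot (l : List DyckStep) : Prop :=
  ∀ s ∈ l.tails, s.count U ≤ s.count D

instance : DecidablePred IsBallot := fun l =>
  inferInstanceAs (Decidable (∀ s ∈ l.tails, s.count U ≤ s.count D))

lemma IsBallot.count_le {l : List DyckStep} (h : IsBallot l) : l.count U ≤ l.count D :=
  h l (by simp)

lemma isBallot_U_cons {l : List DyckStep} :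
    IsBallot (U :: l) ↔ l.count U + 1 ≤ l.count D ∧ IsBallot l := by
  simp [IsBallot]

lemma isBallot_D_cons {l : List DyckStep} : IsBallot (D :: l) ↔ IsBallot l := by
  refine ⟨fun h => (List.forall_mem_cons.1 h).2, fun h => List.forall_mem_cons.2 ⟨?_, h⟩⟩
  simpa using h.count_le.trans (Nat.le_succ _)

lemma count_D_replicate_U (c : ℕ) : (List.replicate c U).count D = 0 := by
  simp [List.count_replicate]

lemma isBallot_replicate_U_append_D_cons {c : ℕ} {l : List DyckStep} :
    IsBallot (List.replicate c U ++ D :: l) ↔ c + l.count U ≤ l.count D + 1 ∧ IsBallot l := by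
  induction c with
  | zero =>
    rw [List.replicate_zero, List.nil_append, isBallot_D_cons]
    exact ⟨fun h => ⟨by linarith [h.count_le], h⟩, And.right⟩
  | succ c ih =>
    rw [List.replicate_succ, List.cons_append, isBallot_U_cons, ih]
    simp only [List.count_append, List.count_replicate_self, List.count_cons_self, ne_eq,
      reduceCtorEq, not_false_eq_true, List.count_cons_of_ne, count_D_replicate_U]
    exact ⟨fun h => ⟨by omega, h.2.2⟩, fun h => ⟨by omega, by omega, h.2⟩⟩

lemma isBallot_iff_take {l : List DyckStep} (h : l.count U = l.count D) :
    IsBallot l ↔ ∀ i, (l.take i).count D ≤ (l.take i).count U := by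
  have split (x : DyckStep) (i : ℕ) : l.count x = (l.take i).count x + (l.drop i).count x := by
    rw [← List.count_append, List.take_append_drop]
  constructor
  · intro hl i
    have := hl (l.drop i) (by simpa using List.drop_suffix i l)
    have := split U i
    have := split D i
    omega
  · intro hl s hs
    obtain ⟨i, rfl⟩ : ∃ i, s = l.drop i :=
      ⟨_, List.suffix_iff_eq_drop.1 ((List.mem_tails _ _).1 hs)⟩
    have := hl i
    have := split U i
    have := split D i
    omega

lemma exists_eq_replicate_U_append_D_cons {l : List DyckStep} (h : D ∈ l) :
    ∃ c l', l = List.replicate c U ++ D :: l' := by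
  obtain ⟨s, l', rfl, hs⟩ := List.eq_append_cons_of_mem h
  refine ⟨s.length, l', ?_⟩
  rw [← List.eq_replicate_of_mem fun x hx => x.dichotomy.resolve_right fun hD => hs (hD ▸ hx)]

lemma replicate_U_append_D_cons_inj {c c' : ℕ} {l l' : List DyckStep} :
    List.replicate c U ++ D :: l = List.replicate c' U ++ D :: l' ↔ c = c' ∧ l = l' := by
  induction c generalizing c' <;> cases c' <;> simp_all [List.replicate_succ]

/-- The words with `u` letters `U` and `d` letters `D` that are suffixes of Dyck words, as a
`Finset` filtered from all rearrangements of `U ⋯ U D ⋯ D`. -/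
def ballotWords (u d : ℕ) : Finset (List DyckStep) :=
  {l ∈ (List.replicate u U ++ List.replicate d D).permutations.toFinset | IsBallot l}

lemma mem_ballotWords {u d : ℕ} {l : List DyckStep} :
    l ∈ ballotWords u d ↔ l.count U = u ∧ l.count D = d ∧ IsBallot l := by
  have perm_iff : l.Perm (List.replicate u U ++ List.replicate d D) ↔
      l.count U = u ∧ l.count D = d := by
    rw [List.perm_iff_count]
    refine ⟨fun h => ⟨by simpa [List.count_replicate] using h U,
      by simpa [List.count_replicate] using h D⟩, ?_⟩
    rintro ⟨rfl, rfl⟩ (_ | _) <;> simp [List.count_replicate]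
  rw [ballotWords, Finset.mem_filter, List.mem_toFinset, List.mem_permutations, perm_iff, and_assoc]

lemma ballotWords_eq_empty {u d : ℕ} (h : d < u) : ballotWords u d = ∅ := by
  refine Finset.eq_empty_of_forall_notMem fun l hl => ?_
  obtain ⟨rfl, rfl, hbal⟩ := mem_ballotWords.1 hl
  exact h.not_ge hbal.count_le

lemma ballotWords_zero_zero : ballotWords 0 0 = {[]} := by
  ext l
  simp only [ballotWords, List.replicate_zero, List.append_nil, List.permutations_nil,
    Finset.mem_filter, List.mem_toFinset, Finset.mem_singleton, List.mem_singleton]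
  exact and_iff_left_of_imp fun h => by simp [h, IsBallot]

lemma replicate_U_append_D_cons_mem_ballotWords {u d c : ℕ} (h : u ≤ d + 1) {l : List DyckStep} :
    List.replicate c U ++ D :: l ∈ ballotWords u (d + 1) ↔
      ∃ v, c + v = u ∧ l ∈ ballotWords v d := by
  have count_U : (List.replicate c U ++ D :: l).count U = c + l.count U := by simp
  have count_D : (List.replicate c U ++ D :: l).count D = l.count D + 1 := by
    simp [count_D_replicate_U]
  rw [mem_ballotWords, count_U, count_D, isBallot_replicate_U_append_D_cons,
    Nat.add_right_cancel_iff]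
  constructor
  · rintro ⟨hU, hD, -, hl⟩
    exact ⟨l.count U, hU, mem_ballotWords.2 ⟨rfl, hD, hl⟩⟩
  · rintro ⟨v, rfl, hl⟩
    obtain ⟨rfl, rfl, hbal⟩ := mem_ballotWords.1 hl
    exact ⟨rfl, rfl, h, hbal⟩

lemma sum_ballotWords_succ {M : Type*} [AddCommMonoid M] (f : List DyckStep → M) {u d : ℕ}
    (h : u ≤ d + 1) :
    ∑ l ∈ ballotWords u (d + 1), f l = ∑ p ∈ antidiagonal u,
      ∑ l ∈ ballotWords p.2 d, f (List.replicate p.1 U ++ D :: l) := by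
  rw [Finset.sum_sigma']
  symm
  refine Finset.sum_bij (fun x _ => List.replicate x.1.1 U ++ D :: x.2) ?_ ?_ ?_ fun _ _ => rfl
  · rintro ⟨⟨c, v⟩, l⟩ hx
    rw [Finset.mem_sigma, mem_antidiagonal] at hx
    exact (replicate_U_append_D_cons_mem_ballotWords h).2 ⟨v, hx⟩
  · rintro ⟨⟨c, v⟩, l⟩ hx ⟨⟨c', v'⟩, l'⟩ hx' heq
    obtain ⟨rfl, rfl⟩ := replicate_U_append_D_cons_inj.1 heq
    simp only [Finset.mem_sigma, mem_antidiagonal] at hx hx'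
    obtain rfl : v = v' := by omega
    rfl
  · intro l hl
    have hD : D ∈ l := List.count_pos_iff.1 (by rw [(mem_ballotWords.1 hl).2.1]; omega)
    obtain ⟨c, l', rfl⟩ := exists_eq_replicate_U_append_D_cons hD
    obtain ⟨v, hv⟩ := (replicate_U_append_D_cons_mem_ballotWords h).1 hl
    exact ⟨⟨(c, v), l'⟩, by simpa using hv, rfl⟩

lemma sum_dyckWord_eq_sum_ballotWords {M : Type*} [AddCommMonoid M] (f : List DyckStep → M)
    (n : ℕ) :
    ∑ p : {p : DyckWord // p.semilength = n}, f p.1.toList = ∑ l ∈ ballotWords n n, f l := by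
  refine Finset.sum_bij (fun p _ => p.1.toList) ?_ ?_ ?_ fun _ _ => rfl
  · rintro ⟨p, rfl⟩ -
    exact mem_ballotWords.2 ⟨rfl, p.count_U_eq_count_D.symm,
      (isBallot_iff_take p.count_U_eq_count_D).2 p.count_D_le_count_U⟩
  · rintro p - q - h
    exact Subtype.ext (DyckWord.ext h)
  · intro l hl
    obtain ⟨hU, hD, hl⟩ := mem_ballotWords.1 hl
    have hUD := hU.trans hD.symm
    exact ⟨⟨⟨l, hUD, (isBallot_iff_take hUD).1 hl⟩, hU⟩, Finset.mem_univ _, rfl⟩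

section RunWeights

open PowerSeries

variable {R : Type*} [CommRing R]

lemma coeff_sub_X_mul_derivative_mul_pow (ψ : R⟦X⟧) (u d : ℕ) :
    (d + 1) * coeff u ((ψ - X * d⁄dX R ψ) * ψ ^ d) =
      (d + 1 - u) * coeff u (ψ ^ (d + 1)) := by
  have euler : (u : R) * coeff u (ψ ^ (d + 1)) =
      coeff u (X * d⁄dX R (ψ ^ (d + 1))) := by
    rcases u with _ | u
    · simp
    · rw [coeff_succ_X_mul, coeff_derivative]
      push_cast
      ring
  have chain : X * d⁄dX R (ψ ^ (d + 1)) =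
      C (d + 1 : R) * (X * d⁄dX R ψ * ψ ^ d) := by
    rw [derivative_pow]
    push_cast
    simp only [map_add, map_natCast, map_one]
    ring
  rw [chain, coeff_C_mul] at euler
  rw [sub_mul, map_sub, pow_succ', mul_sub]
  rw [pow_succ'] at euler
  linear_combination euler

variable [IsAddTorsionFree R]

/-- For `u = d + 1` both sides vanish, which is the boundary condition of the recursion given by
removing the first block `U ⋯ U D`. -/
theorem sum_ballotWords_of_runWeight {ψ : R⟦X⟧} {ω : List DyckStep → R} (hnil : ω [] = 1)
    (hrun : ∀ c l, ω (List.replicate c U ++ D :: l) = coeff c ψ * ω l)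
    {u d : ℕ} (h : u ≤ d + 1) :
    constantCoeff ψ * ∑ l ∈ ballotWords u d, ω l =
      coeff u ((ψ - X * d⁄dX R ψ) * ψ ^ d) := by
  have boundary (d : ℕ) : constantCoeff ψ * ∑ l ∈ ballotWords (d + 1) d, ω l =
      coeff (d + 1) ((ψ - X * d⁄dX R ψ) * ψ ^ d) := by
    have h := coeff_sub_X_mul_derivative_mul_pow ψ (d + 1) d
    rw [Nat.cast_add_one, sub_self, zero_mul] at h
    rw [ballotWords_eq_empty d.lt_succ_self, Finset.sum_empty, mul_zero]
    refine (nsmul_right_injective d.succ_ne_zero ?_).symm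
    simpa [nsmul_eq_mul] using h
  induction d generalizing u with
  | zero =>
    obtain rfl | rfl : u = 0 ∨ u = 1 := by omega
    · simp [ballotWords_zero_zero, hnil]
    · exact boundary 0
  | succ d ih =>
    obtain rfl | hu : u = d + 2 ∨ u ≤ d + 1 := by omega
    · exact boundary (d + 1)
    · rw [sum_ballotWords_succ ω hu, pow_succ', mul_left_comm, coeff_mul,
        Finset.mul_sum]
      refine Finset.sum_congr rfl fun p hp => ?_
      have hp : p.1 + p.2 = u := mem_antidiagonal.1 hp
      simp only [hrun]
      rw [← ih (by omega), mul_left_comm, ← Finset.mul_sum]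

theorem succ_mul_sum_dyckWord_of_runWeight {ψ : R⟦X⟧} {ω : List DyckStep → R} (hnil : ω [] = 1)
    (hrun : ∀ c l, ω (List.replicate c U ++ D :: l) = coeff c ψ * ω l) (n : ℕ) :
    (n + 1) * (constantCoeff ψ * ∑ p : {p : DyckWord // p.semilength = n}, ω p.1.toList) =
      coeff n (ψ ^ (n + 1)) := by
  rw [sum_dyckWord_eq_sum_ballotWords, sum_ballotWords_of_runWeight hnil hrun n.le_succ,
    coeff_sub_X_mul_derivative_mul_pow]
  ring

end RunWeights

lemma occ_cons (f : List DyckStep) (x : DyckStep) (l : List DyckStep) :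
    occ f (x :: l) = occ f l + if f <+: x :: l then 1 else 0 := by
  simp [occ, List.countP_cons]

lemma occ_UD_replicate_U_append_D_cons (c : ℕ) (l : List DyckStep) :
    occ [U, D] (List.replicate c U ++ D :: l) = (if 1 ≤ c then 1 else 0) + occ [U, D] l := by
  match c with
  | 0 => simp [occ_cons]
  | 1 => simp [occ_cons, add_comm]
  | c + 2 =>
    have ih := occ_UD_replicate_U_append_D_cons (c + 1) l
    rw [List.replicate_succ, List.cons_append, occ_cons, ih]
    simp [List.replicate_succ]

lemma occ_UUD_replicate_U_append_D_cons (c : ℕ) (l : List DyckStep) :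
    occ [U, U, D] (List.replicate c U ++ D :: l) =
      (if 2 ≤ c then 1 else 0) + occ [U, U, D] l := by
  match c with
  | 0 => simp [occ_cons]
  | 1 => simp [occ_cons]
  | 2 => simp [occ_cons, List.replicate_succ, add_comm]
  | c + 3 =>
    have ih := occ_UUD_replicate_U_append_D_cons (c + 2) l
    rw [List.replicate_succ, List.cons_append, occ_cons, ih]
    simp [List.replicate_succ]

section RunSeries

open PowerSeries

variable {R : Type*} [CommRing R]

lemma mk_one_pow (m : ℕ) :
    (PowerSeries.mk 1 : R⟦X⟧) ^ m = PowerSeries.mk fun i => (m.multichoose i : R) := by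
  rcases m with _ | m
  · ext (_ | i) <;> simp [coeff_one]
  · rw [mk_one_pow_eq_mk_choose_add]
    ext i
    rw [coeff_mk, coeff_mk, Nat.multichoose_eq, Nat.add_right_comm, Nat.add_sub_cancel,
      Nat.choose_symm_add]

/-- The generating function `1 + y z + x y z² + x y z³ + ⋯` of the blocks `U ⋯ U D` of a Dyck word:
`z` marks the letters `U`, `y` the factor `UD` and `x` the factor `UUD`. -/
noncomputable def runSeries (x y : R) : R⟦X⟧ :=
  1 + C y * (X * (1 + C x * (X * PowerSeries.mk 1)))

lemma coeff_runSeries (x y : R) (c : ℕ) :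
    coeff c (runSeries x y) = y ^ (if 1 ≤ c then 1 else 0) * x ^ (if 2 ≤ c then 1 else 0) := by
  match c with
  | 0 => simp [runSeries]
  | 1 => simp [runSeries, coeff_one, coeff_succ_X_mul]
  | c + 2 => simp [runSeries, coeff_one, coeff_succ_X_mul]

lemma coeff_runSeries_pow (x y : R) (n N : ℕ) :
    coeff n (runSeries x y ^ N) = ∑ k ∈ Finset.range (N + 1), ∑ m ∈ Finset.range (k + 1),
      y ^ k * x ^ m * ((if k + m ≤ n then
        N.choose k * (k.choose m * m.multichoose (n - (k + m))) else 0 : ℕ) : R) := by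
  have expand : runSeries x y ^ N = ∑ k ∈ Finset.range (N + 1), ∑ m ∈ Finset.range (k + 1),
      C (y ^ k * x ^ m * (N.choose k * k.choose m : ℕ)) *
        (X ^ (k + m) * PowerSeries.mk fun i => (m.multichoose i : R)) := by
    simp only [runSeries, add_comm (1 : R⟦X⟧), add_pow, mul_pow, one_pow, mul_one,
      Finset.mul_sum, Finset.sum_mul, mk_one_pow]
    refine Finset.sum_congr rfl fun k _ => Finset.sum_congr rfl fun m _ => ?_
    push_cast
    simp only [map_mul, map_pow, map_natCast]
    ring
  simp only [expand, map_sum, coeff_C_mul, coeff_X_pow_mul', coeff_mk]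
  refine Finset.sum_congr rfl fun k _ => Finset.sum_congr rfl fun m _ => ?_
  split_ifs <;> push_cast <;> ring

theorem succ_mul_sum_occ [IsAddTorsionFree R] (x y : R) (n : ℕ) :
    (n + 1) * ∑ p : {p : DyckWord // p.semilength = n},
      y ^ occ [U, D] p.1.toList * x ^ occ [U, U, D] p.1.toList =
        coeff n (runSeries x y ^ (n + 1)) := by
  have h := succ_mul_sum_dyckWord_of_runWeight (ψ := runSeries x y)
    (ω := fun l => y ^ occ [U, D] l * x ^ occ [U, U, D] l) (by simp [occ]) (fun c l => ?_) n
  · simpa [runSeries] using h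
  · simp only [coeff_runSeries, occ_UD_replicate_U_append_D_cons,
      occ_UUD_replicate_U_append_D_cons, pow_add]
    ring

end RunSeries

section PathCount

open Polynomial

theorem succ_mul_w (n k m : ℕ) :
    (n + 1) * w n k m = if k + m ≤ n then
      (n + 1).choose k * (k.choose m * m.multichoose (n - (k + m))) else 0 := by
  have monomial_eq (k m c : ℕ) :
      (X ^ k * (C X : ℤ[X][X]) ^ m * (c : ℤ[X][X])) = monomial k (monomial m (c : ℤ)) := by
    rw [← C_mul_X_pow_eq_monomial, ← C_mul_X_pow_eq_monomial]
    simp only [map_mul, map_pow, map_natCast]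
    ring
  have w_eq : (w n k m : ℤ) = ((∑ p : {p : DyckWord // p.semilength = n},
      X ^ occ [U, D] p.1.toList * (C X : ℤ[X][X]) ^ occ [U, U, D] p.1.toList).coeff k).coeff m := by
    have monomial_one (k m : ℕ) := monomial_eq k m 1
    simp only [Nat.cast_one, mul_one] at monomial_one
    simp only [monomial_one, finsetSum_coeff, coeff_monomial, apply_ite (coeff · m), coeff_zero,
      w, Finset.card_filter, ite_and]
    push_cast
    rfl
  have h := congrArg (fun q => (q.coeff k).coeff m) (succ_mul_sum_occ (C X : ℤ[X][X]) X n)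
  simp only [← Nat.cast_add_one, coeff_natCast_mul, ← w_eq] at h
  simp only [coeff_runSeries_pow, monomial_eq, finsetSum_coeff, coeff_monomial,
    apply_ite (coeff · m), coeff_zero, Finset.sum_ite_eq', Finset.sum_ite_irrel,
    Finset.sum_const_zero, Finset.mem_range] at h
  by_cases hk : k < n + 1 + 1
  · by_cases hm : m < k + 1
    · rw [if_pos hk, if_pos hm] at h
      exact_mod_cast h
    · rw [if_pos hk, if_neg hm] at h
      simpa [Nat.choose_eq_zero_of_lt (show k < m by omega), Nat.cast_add_one_ne_zero] using h
  · rw [if_neg hk] at h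
    rw [if_neg (by omega)]
    exact_mod_cast h

end PathCount

end Counting

/-! ### Interlacing of simple real zeros -/

open Polynomial

/-- `p` has positive leading coefficient, degree `d` and the zeros `r 0 > ⋯ > r (d - 1)`, which
are then all its zeros, each of them simple. -/
structure HasSimpleZeros {d : ℕ} (p : ℝ[X]) (r : Fin d → ℝ) : Prop where
  natDegree_eq : p.natDegree = d
  leadingCoeff_pos : 0 < p.leadingCoeff
  strictAnti : StrictAnti r
  isRoot : ∀ i, p.IsRoot (r i)

namespace HasSimpleZeros

variable {d : ℕ} {p : ℝ[X]} {r : Fin d → ℝ}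

lemma ne_zero (h : HasSimpleZeros p r) : p ≠ 0 :=
  leadingCoeff_ne_zero.1 h.leadingCoeff_pos.ne'

lemma roots_eq (h : HasSimpleZeros p r) : p.roots = Finset.univ.val.map r := by
  rw [← Finset.image_val_of_injOn h.strictAnti.injective.injOn]
  refine roots_eq_of_natDegree_le_card_of_ne_zero (fun x hx => ?_) ?_ h.ne_zero
  · obtain ⟨i, -, rfl⟩ := Finset.mem_image.1 hx
    exact h.isRoot i
  · rw [Finset.card_image_of_injective _ h.strictAnti.injective, Finset.card_fin, h.natDegree_eq]

lemma card_roots (h : HasSimpleZeros p r) : p.roots.card = p.natDegree := by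
  rw [h.roots_eq, Multiset.card_map, Finset.card_val, Finset.card_fin, h.natDegree_eq]

lemma realRooted (h : HasSimpleZeros p r) : RealRooted p :=
  splits_iff_card_roots.2 h.card_roots

lemma zerosDesc_eq (h : HasSimpleZeros p r) : zerosDesc p = List.ofFn r := by
  refine List.Perm.eq_of_pairwise (le := (· ≥ ·)) (fun a b _ _ h1 h2 => le_antisymm h2 h1)
    (Multiset.pairwise_sort _ _) (List.pairwise_ofFn.2 fun i j hij => (h.strictAnti hij).le) ?_
  rw [← Multiset.coe_eq_coe, zerosDesc, Multiset.sort_eq, h.roots_eq, Fin.univ_val_map]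

lemma eq_C_mul_nodal (h : HasSimpleZeros p r) :
    p = C p.leadingCoeff * Lagrange.nodal Finset.univ r := by
  conv_lhs => rw [← C_leadingCoeff_mul_prod_multiset_X_sub_C h.card_roots, h.roots_eq,
    Multiset.map_map]
  rfl

lemma derivative_sign (h : HasSimpleZeros p r) (i : Fin d) :
    0 < (-1) ^ (i : ℕ) * p.derivative.eval (r i) := by
  have sign : (-1 : ℝ) ^ (i : ℕ) = ∏ j ∈ Finset.univ.erase i, if j < i then -1 else 1 := by
    rw [Finset.prod_ite, Finset.prod_const, Finset.prod_const_one, mul_one, ← Fin.card_Iio i]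
    congr 2
    ext j
    simpa using fun hj => hj.ne
  have derivative_eq : p.derivative.eval (r i) =
      p.leadingCoeff * ∏ j ∈ Finset.univ.erase i, (r i - r j) := by
    conv_lhs => rw [h.eq_C_mul_nodal]
    rw [derivative_C_mul, eval_mul, eval_C,
      Lagrange.eval_nodal_derivative_eval_node_eq (Finset.mem_univ i), Lagrange.eval_nodal]
  rw [derivative_eq, mul_left_comm, sign, ← Finset.prod_mul_distrib]
  refine mul_pos h.leadingCoeff_pos (Finset.prod_pos fun j hj => ?_)
  rcases (Finset.ne_of_mem_erase hj).lt_or_gt with hji | hij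
  · rw [if_pos hji]
    linarith [h.strictAnti hji]
  · rw [if_neg hij.not_gt]
    linarith [h.strictAnti hij]

lemma derivative_ne_zero (h : HasSimpleZeros p r) (i : Fin d) : p.derivative.eval (r i) ≠ 0 :=
  right_ne_zero_of_mul (h.derivative_sign i).ne'

end HasSimpleZeros

lemma exists_isRoot_mem_Ioo {p : ℝ[X]} {a b ε : ℝ} (hab : a < b) (hb : 0 < ε * p.eval b)
    (ha : 0 < -ε * p.eval a) : ∃ x ∈ Set.Ioo a b, p.IsRoot x := by
  have cont : ContinuousOn (fun x => ε * p.eval x) (Set.Icc a b) :=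
    (continuous_const.mul p.continuous).continuousOn
  obtain ⟨x, hx, hx0⟩ := intermediate_value_Ioo hab.le cont ⟨by linarith, hb⟩
  exact ⟨x, hx, (mul_eq_zero.1 hx0).resolve_left (left_ne_zero_of_mul hb.ne')⟩

lemma exists_isRoot_of_sign_alternates {p : ℝ[X]} {n : ℕ} {t : Fin (n + 1) → ℝ}
    (ht : StrictAnti t) (hsign : ∀ i : Fin (n + 1), 0 < (-1) ^ (i : ℕ) * p.eval (t i)) :
    ∃ s : Fin n → ℝ, StrictAnti s ∧ ∀ i, p.IsRoot (s i) ∧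
      s i ∈ Set.Ioo (t i.succ) (t i.castSucc) := by
  have root (i : Fin n) : ∃ x ∈ Set.Ioo (t i.succ) (t i.castSucc), p.IsRoot x := by
    refine exists_isRoot_mem_Ioo (ht i.castSucc_lt_succ) (hsign i.castSucc) ?_
    simpa [pow_succ] using hsign i.succ
  choose s hs hroot using root
  refine ⟨s, fun i j hij => ?_, fun i => ⟨hroot i, hs i⟩⟩
  calc s j < t j.castSucc := (hs j).2
    _ ≤ t i.succ := ht.antitone (Fin.succ_le_castSucc_iff.2 hij)
    _ < s i := (hs i).1

lemma exists_gt_eval_pos {p : ℝ[X]} (hp : 0 < p.leadingCoeff) (hdeg : 0 < p.natDegree) (a : ℝ) :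
    ∃ x > a, 0 < p.eval x := by
  have lim := tendsto_atTop_of_leadingCoeff_nonneg p (natDegree_pos_iff_degree_pos.1 hdeg) hp.le
  exact ((Filter.eventually_gt_atTop a).and (lim.eventually_gt_atTop 0)).exists

lemma exists_lt_neg_one_pow_mul_eval_pos {p : ℝ[X]} (hp : 0 < p.leadingCoeff)
    (hdeg : 0 < p.natDegree) (a : ℝ) : ∃ x < a, 0 < (-1) ^ p.natDegree * p.eval x := by
  have natDegree_eq : (C ((-1) ^ p.natDegree) * p.comp (-X)).natDegree = p.natDegree := by
    rw [natDegree_C_mul (by simp), natDegree_comp, natDegree_neg, natDegree_X, mul_one]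
  have leadingCoeff_eq :
      (C ((-1) ^ p.natDegree) * p.comp (-X)).leadingCoeff = p.leadingCoeff := by
    rw [leadingCoeff_mul, leadingCoeff_C, leadingCoeff_comp (by simp), leadingCoeff_neg,
      leadingCoeff_X, mul_left_comm, ← mul_pow, neg_one_mul, neg_neg, one_pow, mul_one]
  obtain ⟨y, hy, hpos⟩ := exists_gt_eval_pos (hp.trans_eq leadingCoeff_eq.symm)
    (hdeg.trans_eq natDegree_eq.symm) (-a)
  exact ⟨-y, by linarith, by simpa using hpos⟩

lemma strictAnti_cons {α : Type*} [Preorder α] {n : ℕ} {a : α} {f : Fin n → α}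
    (hf : StrictAnti f) (ha : ∀ i, f i < a) : StrictAnti (Fin.cons a f : Fin (n + 1) → α) := by
  intro i j hij
  obtain ⟨j, rfl⟩ := Fin.exists_succ_eq.2 (Fin.ne_zero_of_lt hij)
  cases i using Fin.cases with
  | zero => exact ha j
  | succ i => exact hf (Fin.succ_lt_succ_iff.1 hij)

lemma strictAnti_snoc {α : Type*} [Preorder α] {n : ℕ} {a : α} {f : Fin n → α}
    (hf : StrictAnti f) (ha : ∀ i, a < f i) : StrictAnti (Fin.snoc f a : Fin (n + 1) → α) := by
  intro i j hij
  obtain ⟨i, rfl⟩ := Fin.exists_castSucc_eq.2 (Fin.ne_last_of_lt hij)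
  cases j using Fin.lastCases with
  | last => simpa using ha i
  | cast j => simpa using hf (Fin.castSucc_lt_castSucc_iff.1 hij)

lemma exists_hasSimpleZeros_of_sign_alternates {d : ℕ} {p : ℝ[X]} {r : Fin d → ℝ}
    (hr : StrictAnti r) (hdeg : p.natDegree = d + 1) (hp : 0 < p.leadingCoeff)
    (hsign : ∀ i : Fin d, 0 < (-1) ^ (i + 1 : ℕ) * p.eval (r i)) :
    ∃ s : Fin (d + 1) → ℝ, HasSimpleZeros p s ∧
      ∀ i, r i ∈ Set.Ioo (s i.succ) (s i.castSucc) := by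
  obtain ⟨upper, hupper⟩ := (Set.finite_range r).bddAbove
  obtain ⟨lower, hlower⟩ := (Set.finite_range r).bddBelow
  obtain ⟨M, hM, hpM⟩ := exists_gt_eval_pos hp (by omega) upper
  obtain ⟨m, hm, hpm⟩ := exists_lt_neg_one_pow_mul_eval_pos hp (by omega) (min lower M)
  have lt_M (i) : r i < M := (hupper ⟨i, rfl⟩).trans_lt hM
  have m_lt (i) : m < r i := (hm.trans_le (min_le_left _ _)).trans_le (hlower ⟨i, rfl⟩)
  let t : Fin (d + 2) → ℝ := Fin.cons M (Fin.snoc r m : Fin (d + 1) → ℝ)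
  have t_mid (i : Fin d) : t i.castSucc.succ = r i := by simp [t]
  have ht : StrictAnti t := by
    refine strictAnti_cons (strictAnti_snoc hr m_lt) fun i => ?_
    cases i using Fin.lastCases with
    | last => simpa using hm.trans_le (min_le_right _ _)
    | cast i => simpa using lt_M i
  have t_sign (i : Fin (d + 2)) : 0 < (-1) ^ (i : ℕ) * p.eval (t i) := by
    cases i using Fin.cases with
    | zero => simpa [t] using hpM
    | succ i =>
      cases i using Fin.lastCases with
      | last => simpa [t, hdeg] using hpm
      | cast i => simpa [t_mid] using hsign i
  obtain ⟨s, hs, hroot⟩ := exists_isRoot_of_sign_alternates ht t_sign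
  refine ⟨s, ⟨hdeg, hp, hs, fun i => (hroot i).1⟩, fun i => ?_⟩
  rw [← t_mid]
  exact ⟨(hroot i.succ).2.2, (hroot i.castSucc).2.1⟩

theorem HasSimpleZeros.exists_interlacing {d : ℕ} {p q : ℝ[X]} {r : Fin d → ℝ}
    (hq : HasSimpleZeros q r) (hdeg : p.natDegree = d + 1) (hp : 0 < p.leadingCoeff)
    (hsign : ∀ i, p.eval (r i) * q.derivative.eval (r i) < 0) :
    ∃ s : Fin (d + 1) → ℝ, HasSimpleZeros p s ∧
      ∀ i, r i ∈ Set.Ioo (s i.succ) (s i.castSucc) := by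
  refine exists_hasSimpleZeros_of_sign_alternates hq.strictAnti hdeg hp fun i => ?_
  refine pos_of_mul_pos_left ?_ (hq.derivative_sign i).le
  calc 0 < -(p.eval (r i) * q.derivative.eval (r i)) := neg_pos.2 (hsign i)
    _ = ((-1) ^ (i : ℕ) * (-1) ^ (i : ℕ)) * -(p.eval (r i) * q.derivative.eval (r i)) := by
      rw [← mul_pow, neg_one_mul, neg_neg, one_pow, one_mul]
    _ = _ := by ring

section OrderedCoeff

variable {R : Type*} [Semiring R]

lemma coeff_zero_le_eval [PartialOrder R] [IsOrderedRing R] {p : R[X]} (hp : ∀ i, 0 ≤ p.coeff i)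
    {x : R} (hx : 0 ≤ x) :
    p.coeff 0 ≤ p.eval x := by
  rw [eval_eq_sum_range]
  simpa using Finset.single_le_sum (f := fun i => p.coeff i * x ^ i)
    (fun i _ => mul_nonneg (hp i) (pow_nonneg hx i)) (Finset.mem_range.2 p.natDegree.succ_pos)

lemma neg_of_isRoot [LinearOrder R] [IsOrderedRing R] {p : R[X]} (hp : ∀ i, 0 ≤ p.coeff i)
    (hp0 : p.coeff 0 ≠ 0) {x : R} (hx : p.IsRoot x) : x < 0 := by
  by_contra! hx0
  exact hp0 (((coeff_zero_le_eval hp hx0).trans_eq hx).antisymm (hp 0))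

lemma coeff_C_mul_nonneg [PartialOrder R] [PosMulMono R] {c : R} (hc : 0 ≤ c) {p : R[X]}
    (hp : ∀ i, 0 ≤ p.coeff i) (i : ℕ) :
    0 ≤ (C c * p).coeff i := by
  rw [coeff_C_mul]
  exact mul_nonneg hc (hp i)

lemma coeff_X_mul_nonneg [Preorder R] {p : R[X]} (hp : ∀ i, 0 ≤ p.coeff i) (i : ℕ) :
    0 ≤ (X * p).coeff i := by
  rcases i with _ | i
  · simp
  · rw [coeff_X_mul]
    exact hp i

end OrderedCoeff

namespace HasSimpleZeros

variable {d : ℕ} {p q : ℝ[X]} {r : Fin d → ℝ} {s : Fin (d + 1) → ℝ} {a b : ℝ}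

lemma C_mul_X_mul (h : HasSimpleZeros p r) (hr : ∀ i, r i < 0) (ha : 0 < a) :
    HasSimpleZeros (C a * (X * p)) (Fin.cons 0 r : Fin (d + 1) → ℝ) where
  natDegree_eq := by rw [natDegree_C_mul ha.ne', natDegree_X_mul h.ne_zero, h.natDegree_eq]
  leadingCoeff_pos := by simpa using mul_pos ha h.leadingCoeff_pos
  strictAnti := strictAnti_cons h.strictAnti hr
  isRoot i := by
    cases i using Fin.cases with
    | zero => simp
    | succ i => simp [(h.isRoot i).eq_zero]

lemma interlaces (hp : HasSimpleZeros p r) (hq : HasSimpleZeros q s)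
    (hp_coeff : ∀ i, 0 ≤ p.coeff i) (hq_coeff : ∀ i, 0 ≤ q.coeff i)
    (h : ∀ i, r i ∈ Set.Icc (s i.succ) (s i.castSucc)) : Interlaces p q := by
  refine ⟨hp.realRooted, hq.realRooted, .inl ⟨hp_coeff, hq_coeff, hp.ne_zero, hq.ne_zero, .inr ?_,
    ?_⟩⟩
  · rw [hp.natDegree_eq, hq.natDegree_eq]
  · simp only [hp.zerosDesc_eq, hq.zerosDesc_eq, Alternates, List.length_ofFn, List.getElem_ofFn]
    exact ⟨fun i hi _ => (h ⟨i, hi⟩).2, fun i hi _ => (h ⟨i, hi⟩).1⟩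

lemma interlaces_C_mul_X_mul (hp : HasSimpleZeros p r) (hq : HasSimpleZeros q s)
    (hp_coeff : ∀ i, 0 ≤ p.coeff i) (hq_coeff : ∀ i, 0 ≤ q.coeff i)
    (hr : ∀ i, r i < 0) (hs : ∀ i, s i < 0)
    (h : ∀ i, r i ∈ Set.Icc (s i.succ) (s i.castSucc)) (ha : 0 < a) (hb : 0 < b) :
    Interlaces (C a * (X * p)) (C b * (X * q)) := by
  refine (hp.C_mul_X_mul hr ha).interlaces (hq.C_mul_X_mul hs hb)
    (coeff_C_mul_nonneg ha.le (coeff_X_mul_nonneg hp_coeff))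
    (coeff_C_mul_nonneg hb.le (coeff_X_mul_nonneg hq_coeff)) fun i => ?_
  cases i using Fin.cases with
  | zero => exact ⟨(hs 0).le, le_rfl⟩
  | succ i => exact h i

end HasSimpleZeros

lemma interlaces_C_mul_C_mul {p : ℝ[X]} (hp : RealRooted p) (hp0 : p ≠ 0)
    (hp_coeff : ∀ i, 0 ≤ p.coeff i) {a b : ℝ} (ha : 0 < a) (hb : 0 < b) :
    Interlaces (C a * p) (C b * p) := by
  refine ⟨hp.C_mul a, hp.C_mul b, .inl ⟨coeff_C_mul_nonneg ha.le hp_coeff,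
    coeff_C_mul_nonneg hb.le hp_coeff, mul_ne_zero (C_ne_zero.2 ha.ne') hp0,
    mul_ne_zero (C_ne_zero.2 hb.ne') hp0, .inl ?_, ?_⟩⟩
  · rw [natDegree_C_mul ha.ne', natDegree_C_mul hb.ne']
  · rw [zerosDesc, zerosDesc, roots_C_mul _ ha.ne', roots_C_mul _ hb.ne']
    exact ⟨fun _ _ _ => le_rfl, fun i _ _ => List.pairwise_iff_getElem.1
      (Multiset.pairwise_sort p.roots (· ≥ ·)) _ _ _ _ i.lt_succ_self⟩

/-! ### Generalized Narayana polynomials -/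

lemma succ_mul_cast_choose_succ (R : Type*) [CommRing R] (n j : ℕ) :
    ((j : R) + 1) * n.choose (j + 1) = (n - j) * n.choose j := by
  have absorb : ((n : R) + 1) * n.choose j = (n.choose j + n.choose (j + 1)) * (j + 1) := by
    exact_mod_cast congrArg (Nat.cast (R := R)) (Nat.add_one_mul_choose_eq n j)
  linear_combination -absorb

lemma sub_mul_cast_succ_choose (R : Type*) [CommRing R] (n j : ℕ) :
    ((n : R) + 1 - j) * (n + 1).choose j = (n + 1) * n.choose j := by
  have absorb : ((n : R) + 1) * n.choose j = (n + 1).choose (j + 1) * (j + 1) := by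
    exact_mod_cast congrArg (Nat.cast (R := R)) (Nat.add_one_mul_choose_eq n j)
  have := succ_mul_cast_choose_succ R (n + 1) j
  push_cast at this
  linear_combination -this - absorb

/-- The generalized Narayana polynomial `∑ⱼ C(a, j) C(b, j) / (j + 1) xʲ`. The case `a = n - 1`,
`b = n` is the classical one, and `W_{n,k}` is a multiple of `x` times the one with `a = k - 1`,
`b = n - k - 1`. -/
noncomputable def narayanaPoly (a b : ℕ) : ℝ[X] :=
  ∑ j ∈ Finset.range (a + 1), C ((a.choose j * b.choose j : ℝ) / (j + 1)) * X ^ j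

lemma coeff_narayanaPoly (a b j : ℕ) :
    (narayanaPoly a b).coeff j = (a.choose j * b.choose j : ℝ) / (j + 1) := by
  simp only [narayanaPoly, finsetSum_coeff, coeff_C_mul_X_pow, Finset.sum_ite_eq,
    Finset.mem_range]
  refine ite_eq_left_iff.2 fun h => ?_
  rw [Nat.choose_eq_zero_of_lt (by omega), Nat.cast_zero, zero_mul, zero_div]

lemma narayanaPoly_comm (a b : ℕ) : narayanaPoly a b = narayanaPoly b a := by
  ext j
  rw [coeff_narayanaPoly, coeff_narayanaPoly, mul_comm (a.choose j : ℝ)]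

lemma coeff_narayanaPoly_nonneg (a b j : ℕ) : 0 ≤ (narayanaPoly a b).coeff j := by
  rw [coeff_narayanaPoly]
  positivity

lemma coeff_zero_narayanaPoly (a b : ℕ) : (narayanaPoly a b).coeff 0 = 1 := by
  simp [coeff_narayanaPoly]

lemma narayanaPoly_zero_left (b : ℕ) : narayanaPoly 0 b = 1 := by
  simp [narayanaPoly]

lemma narayanaPoly_ne_zero (a b : ℕ) : narayanaPoly a b ≠ 0 := fun h => by
  simpa [h] using coeff_zero_narayanaPoly a b

lemma neg_of_isRoot_narayanaPoly {a b : ℕ} {x : ℝ} (hx : (narayanaPoly a b).IsRoot x) : x < 0 :=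
  neg_of_isRoot (coeff_narayanaPoly_nonneg a b) (by simp [coeff_zero_narayanaPoly]) hx

lemma coeff_narayanaPoly_self_pos {a b : ℕ} (h : a ≤ b) : 0 < (narayanaPoly a b).coeff a := by
  have : 0 < b.choose a := Nat.choose_pos h
  rw [coeff_narayanaPoly, Nat.choose_self]
  positivity

lemma natDegree_narayanaPoly {a b : ℕ} (h : a ≤ b) : (narayanaPoly a b).natDegree = a := by
  refine natDegree_eq_of_le_of_coeff_ne_zero (natDegree_le_iff_coeff_eq_zero.2 fun j hj => ?_)
    (coeff_narayanaPoly_self_pos h).ne'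
  rw [coeff_narayanaPoly, Nat.choose_eq_zero_of_lt hj, Nat.cast_zero, zero_mul, zero_div]

lemma leadingCoeff_narayanaPoly_pos {a b : ℕ} (h : a ≤ b) :
    0 < (narayanaPoly a b).leadingCoeff := by
  rw [leadingCoeff, natDegree_narayanaPoly h]
  exact coeff_narayanaPoly_self_pos h

theorem narayanaPoly_succ_left (a b : ℕ) :
    C ((a : ℝ) + 2) * narayanaPoly (a + 1) b =
      (C ((a : ℝ) + 2) + C (b : ℝ) * X) * narayanaPoly a b +
        X * (1 - X) * derivative (narayanaPoly a b) := by
  have expand : (C ((a : ℝ) + 2) + C (b : ℝ) * X) * narayanaPoly a b +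
        X * (1 - X) * derivative (narayanaPoly a b) =
      C ((a : ℝ) + 2) * narayanaPoly a b + C (b : ℝ) * (X * narayanaPoly a b) +
        (X * derivative (narayanaPoly a b) - X * (X * derivative (narayanaPoly a b))) := by ring
  have coeff_euler (j : ℕ) : (X * derivative (narayanaPoly a b)).coeff j =
      j * (narayanaPoly a b).coeff j := by
    rcases j with _ | j
    · simp
    · rw [coeff_X_mul, coeff_derivative]
      push_cast
      ring
  rw [expand]
  ext (_ | j)
  · simp [coeff_narayanaPoly]
  · simp only [coeff_add, coeff_sub, coeff_C_mul, coeff_euler, coeff_X_mul, coeff_narayanaPoly,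
      Nat.choose_succ_succ a j]
    have ha := succ_mul_cast_choose_succ ℝ a j
    have hb := succ_mul_cast_choose_succ ℝ b j
    push_cast
    field_simp
    linear_combination ((j : ℝ) + 2) * a.choose j * hb - ((j : ℝ) + 1) * b.choose (j + 1) * ha

theorem narayanaPoly_shift (a b : ℕ) :
    C ((b : ℝ) + 1) * narayanaPoly (a + 1) b =
      C ((b : ℝ) - a) * narayanaPoly (a + 1) (b + 1) +
        C ((a : ℝ) + 1) * narayanaPoly a (b + 1) := by
  ext j
  simp only [coeff_add, coeff_C_mul, coeff_narayanaPoly]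
  field_simp
  linear_combination ((b + 1).choose j : ℝ) * sub_mul_cast_succ_choose ℝ a j -
    ((a + 1).choose j : ℝ) * sub_mul_cast_succ_choose ℝ b j

lemma narayanaPoly_succ_left_mul_derivative_neg {a b : ℕ} {x : ℝ}
    (hx : (narayanaPoly a b).IsRoot x) (hsimple : (narayanaPoly a b).derivative.eval x ≠ 0) :
    (narayanaPoly (a + 1) b).eval x * (narayanaPoly a b).derivative.eval x < 0 := by
  have hx0 : x < 0 := neg_of_isRoot_narayanaPoly hx
  have recurrence := congrArg (eval x) (narayanaPoly_succ_left a b)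
  simp only [eval_mul, eval_add, eval_sub, eval_C, eval_X, eval_one, hx.eq_zero, mul_zero,
    zero_add] at recurrence
  refine neg_of_mul_neg_right (a := (a : ℝ) + 2) ?_ (by positivity)
  rw [← mul_assoc, recurrence, mul_assoc]
  exact mul_neg_of_neg_of_pos (mul_neg_of_neg_of_pos hx0 (by linarith))
    (mul_self_pos.2 hsimple)

theorem exists_hasSimpleZeros_narayanaPoly {a b : ℕ} (h : a ≤ b) :
    ∃ r : Fin a → ℝ, HasSimpleZeros (narayanaPoly a b) r := by
  induction a with
  | zero =>
    exact ⟨Fin.elim0, natDegree_narayanaPoly h, leadingCoeff_narayanaPoly_pos h,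
      fun i => i.elim0, fun i => i.elim0⟩
  | succ a ih =>
    obtain ⟨r, hr⟩ := ih (by omega)
    obtain ⟨s, hs, -⟩ := hr.exists_interlacing (natDegree_narayanaPoly h)
      (leadingCoeff_narayanaPoly_pos h) fun i =>
        narayanaPoly_succ_left_mul_derivative_neg (hr.isRoot i) (hr.derivative_ne_zero i)
    exact ⟨s, hs⟩

lemma realRooted_narayanaPoly (a b : ℕ) : RealRooted (narayanaPoly a b) := by
  wlog h : a ≤ b generalizing a b
  · rw [narayanaPoly_comm]
    exact this b a (le_of_not_ge h)
  obtain ⟨r, hr⟩ := exists_hasSimpleZeros_narayanaPoly h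
  exact hr.realRooted

theorem interlaces_narayanaPoly {a b : ℕ} (h : a < b) {c c' : ℝ} (hc : 0 < c) (hc' : 0 < c') :
    Interlaces (C c * (X * narayanaPoly a (b + 1))) (C c' * (X * narayanaPoly (a + 1) b)) := by
  obtain ⟨r, hr⟩ := exists_hasSimpleZeros_narayanaPoly (h.le.trans b.le_succ)
  have sign (i : Fin a) : (narayanaPoly (a + 1) b).eval (r i) *
      (narayanaPoly a (b + 1)).derivative.eval (r i) < 0 := by
    have shift := congrArg (eval (r i)) (narayanaPoly_shift a b)
    simp only [eval_mul, eval_add, eval_C, (hr.isRoot i).eq_zero, mul_zero, add_zero] at shift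
    refine neg_of_mul_neg_right (a := (b : ℝ) + 1) ?_ (by positivity)
    rw [← mul_assoc, shift, mul_assoc]
    exact mul_neg_of_pos_of_neg (sub_pos.2 (Nat.cast_lt.2 h))
      (narayanaPoly_succ_left_mul_derivative_neg (hr.isRoot i) (hr.derivative_ne_zero i))
  obtain ⟨s, hs, hrs⟩ :=
    hr.exists_interlacing (natDegree_narayanaPoly h) (leadingCoeff_narayanaPoly_pos h) sign
  exact hr.interlaces_C_mul_X_mul hs (coeff_narayanaPoly_nonneg _ _)
    (coeff_narayanaPoly_nonneg _ _) (fun i => neg_of_isRoot_narayanaPoly (hr.isRoot i))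
    (fun i => neg_of_isRoot_narayanaPoly (hs.isRoot i)) (fun i => Set.Ioo_subset_Icc_self (hrs i))
    hc hc'

/-! ### The polynomials `W_{n,k}` -/

lemma coeff_W (n k m : ℕ) : (W n k).coeff m = if m ≤ k then (w n k m : ℝ) else 0 := by
  simp only [W, finsetSum_coeff, coeff_C_mul_X_pow, Finset.sum_ite_eq, Finset.mem_range,
    Order.lt_add_one_iff]

lemma w_eq_zero_of_lt {n k m : ℕ} (h : n < k + m) : w n k m = 0 := by
  have := succ_mul_w n k m
  rw [if_neg h.not_ge] at this
  exact (mul_eq_zero.1 this).resolve_left n.succ_ne_zero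

lemma w_zero_right {n k : ℕ} (h : k < n) : w n k 0 = 0 := by
  obtain ⟨i, rfl⟩ := Nat.exists_eq_add_of_lt h
  have count := succ_mul_w (k + i + 1) k 0
  rw [if_pos (by omega), show k + i + 1 - (k + 0) = i + 1 by omega, Nat.multichoose_zero_succ,
    mul_zero, mul_zero] at count
  exact (mul_eq_zero.1 count).resolve_left (Nat.succ_ne_zero _)

lemma succ_mul_w_succ (a b m : ℕ) :
    (m + 1) * w (a + b + 2) (a + 1) (m + 1) =
      (a + b + 2).choose a * (a.choose m * b.choose m) := by
  rcases le_or_gt m b with hm | hm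
  · obtain ⟨i, rfl⟩ := Nat.exists_eq_add_of_le hm
    set n := a + (m + i) + 2
    have count := succ_mul_w n (a + 1) (m + 1)
    rw [if_pos (by omega), show n - (a + 1 + (m + 1)) = i by omega, Nat.multichoose_eq,
      show m + 1 + i - 1 = m + i by omega, ← Nat.choose_symm_add] at count
    have absorb_n := Nat.add_one_mul_choose_eq n a
    have absorb_a := Nat.add_one_mul_choose_eq a m
    refine Nat.eq_of_mul_eq_mul_left n.succ_pos ?_
    calc (n + 1) * ((m + 1) * w n (a + 1) (m + 1))
        = (m + 1) * ((n + 1) * w n (a + 1) (m + 1)) := by ring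
      _ = (n + 1).choose (a + 1) * ((a + 1).choose (m + 1) * (m + 1)) * (m + i).choose m := by
        rw [count]; ring
      _ = (n + 1).choose (a + 1) * (a + 1) * a.choose m * (m + i).choose m := by
        rw [← absorb_a]; ring
      _ = (n + 1) * (n.choose a * (a.choose m * (m + i).choose m)) := by
        rw [← absorb_n]; ring
  · rw [w_eq_zero_of_lt (by omega), Nat.choose_eq_zero_of_lt hm, mul_zero, mul_zero, mul_zero]

theorem W_eq_narayanaPoly (a b : ℕ) :
    W (a + b + 2) (a + 1) = C ((a + b + 2).choose a : ℝ) * (X * narayanaPoly a b) := by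
  ext (_ | m)
  · simp [coeff_W, w_zero_right (show a + 1 < a + b + 2 by omega)]
  · have count : ((m : ℝ) + 1) * w (a + b + 2) (a + 1) (m + 1) =
        (a + b + 2).choose a * (a.choose m * b.choose m) := by
      exact_mod_cast succ_mul_w_succ a b m
    rw [coeff_W, coeff_C_mul, coeff_X_mul, coeff_narayanaPoly, mul_div_assoc', ← count,
      mul_div_cancel_left₀ _ (by positivity)]
    refine ite_eq_left_iff.2 fun hm => ?_
    rw [Nat.choose_eq_zero_of_lt (by omega : a < m), Nat.cast_zero, zero_mul, mul_zero] at count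
    exact ((mul_eq_zero.1 count).resolve_left (by positivity)).symm

lemma W_self (n : ℕ) : W n n = C (w n n 0 : ℝ) := by
  ext (_ | m)
  · simp [coeff_W]
  · simp [coeff_W, w_eq_zero_of_lt (show n < n + (m + 1) by omega)]

lemma realRooted_W {n k : ℕ} (hk : 1 ≤ k) (hkn : k ≤ n) : RealRooted (W n k) := by
  obtain ⟨a, rfl⟩ := Nat.exists_eq_add_of_le' hk
  obtain rfl | h := hkn.eq_or_lt
  · rw [W_self]
    exact Splits.C _
  · obtain ⟨b, rfl⟩ : ∃ b, n = a + b + 2 := ⟨n - a - 2, by omega⟩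
    rw [W_eq_narayanaPoly]
    exact (Splits.X.mul (realRooted_narayanaPoly a b)).C_mul _

lemma interlaces_W_succ {n k : ℕ} (hk : 1 ≤ k) (h : 2 * (k + 1) ≤ n) :
    Interlaces (W n k) (W n (k + 1)) := by
  obtain ⟨a, rfl⟩ := Nat.exists_eq_add_of_le' hk
  obtain ⟨b, rfl⟩ : ∃ b, n = a + (b + 1) + 2 := ⟨n - a - 3, by omega⟩
  rw [W_eq_narayanaPoly, show a + (b + 1) + 2 = a + 1 + b + 2 by ring, W_eq_narayanaPoly]
  exact interlaces_narayanaPoly (by omega) (Nat.cast_pos.2 (Nat.choose_pos (by omega)))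
    (Nat.cast_pos.2 (Nat.choose_pos (by omega)))

lemma interlaces_W_self {k : ℕ} (hk : 1 ≤ k) :
    Interlaces (W (k + 1) (k + 1)) (W (k + 1) k) := by
  refine ⟨realRooted_W (by omega) le_rfl, realRooted_W hk k.le_succ, .inr (.inl
    ⟨w (k + 1) (k + 1) 0, (k + 1).choose (k - 1), 0, W_self _, ?_⟩)⟩
  obtain ⟨a, rfl⟩ := Nat.exists_eq_add_of_le' hk
  rw [W_eq_narayanaPoly a 0, narayanaPoly_comm, narayanaPoly_zero_left]
  simp

lemma interlaces_W_middle (a : ℕ) :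
    Interlaces (W (2 * a + 3) (a + 2)) (W (2 * a + 3) (a + 1)) := by
  have upper := W_eq_narayanaPoly (a + 1) a
  have lower := W_eq_narayanaPoly a (a + 1)
  rw [show a + 1 + a + 2 = 2 * a + 3 by ring, narayanaPoly_comm] at upper
  rw [show a + (a + 1) + 2 = 2 * a + 3 by ring] at lower
  rw [upper, lower]
  exact interlaces_C_mul_C_mul (Splits.X.mul (realRooted_narayanaPoly _ _))
    (mul_ne_zero X_ne_zero (narayanaPoly_ne_zero _ _))
    (coeff_X_mul_nonneg (coeff_narayanaPoly_nonneg _ _))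
    (Nat.cast_pos.2 (Nat.choose_pos (by omega))) (Nat.cast_pos.2 (Nat.choose_pos (by omega)))

lemma interlaces_succ_W {n k : ℕ} (hk : 1 ≤ k) (hkn : k < n) (h : n ≤ 2 * k + 1) :
    Interlaces (W n (k + 1)) (W n k) := by
  obtain ⟨a, rfl⟩ := Nat.exists_eq_add_of_le' hk
  obtain rfl | hlt := Nat.eq_or_lt_of_le hkn
  · exact interlaces_W_self hk
  obtain rfl | hne := eq_or_ne n (2 * a + 3)
  · exact interlaces_W_middle a
  · obtain ⟨b, rfl⟩ : ∃ b, n = a + (b + 1) + 2 := ⟨n - a - 3, by omega⟩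
    rw [W_eq_narayanaPoly a, show a + (b + 1) + 2 = a + 1 + b + 2 by ring, W_eq_narayanaPoly,
      narayanaPoly_comm, narayanaPoly_comm a]
    exact interlaces_narayanaPoly (by omega) (Nat.cast_pos.2 (Nat.choose_pos (by omega)))
      (Nat.cast_pos.2 (Nat.choose_pos (by omega)))

end DyckSturm

theorem theorem2p7 (n : ℕ) (hn : 1 ≤ n) :
    DyckSturm.SturmUnimodal n (fun k => DyckSturm.W n k) := by
  refine ⟨fun i => DyckSturm.realRooted_W, max 1 (n / 2), le_max_left _ _, ?_, ?_, ?_⟩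
  · omega
  · intro i hi hij
    exact DyckSturm.interlaces_W_succ hi (by omega)
  · intro i hji hin
    exact DyckSturm.interlaces_succ_W (by omega) hin (by omega)
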